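/- Let $G$ be a finite bipartite graph in which every vertex has degree at least $1$ and at most $4$; its vertices are unit-length jobs and its edges are conflicts. Let $M_1,M_2,M_3,M_4$ be machines with real speeds $s_1,s_2,s_3,s_4>0$. A schedule is a partition of $V(G)$ into independent sets $J_1,\dots,J_4$ (possibly empty), where $J_i$ is processed on $M_i$; its length is $\max_{1\le i\le 4}|J_i|/s_i$, and it is optimal if no schedule is shorter. Consider the following algorithm, in which every choice is arbitrary. 1. Find an independent set $I_0$ of maximum size in $G$ and put $I_1:=I_0$. 2. As long as $G$ has a subgraph $K_{3,3}$ such that $I_1$ contains $6$ vertices outside this $K_{3,3}$ that each have a neighbor in it: choose such a $K_{3,3}$, a vertex $v$ of it and a neighbor $u\in I_1\cap I_0$ of $v$, and set $I_1:=(I_1\cup\{v\})\setminus\{u\}$. 3. Assign $I_1$ to $M_1$. 4. Let $G_1,\dots,G_k$ be the connected components of $G-I_1$. 5. For each $i$ find a proper $3$-coloring of $G_i$ with classes $A_i,B_i,C_i$ such that $|A_i|\le|B_i|\le|C_i|\le|A_i|+1$. 6. Combine these to a $3$-coloring $(X,B,Y)$ of $G-I_1$ whose class sizes differ pairwise by at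 most $1$: for each $i$, the sets $A_i,B_i,C_i$ are distributed, in some order, one to each of $X,B,Y$. 7. Assign $X,B,Y$ to $M_2,M_3,M_4$, respectively. If $s_2=s_3=s_4$ and $s_1\ge 12s_2$, then every run of this algorithm is finite, each of its steps can always be carried out, and the result is an optimal schedule. -/

import Mathlib

/-! Scheduling unit jobs with conflicts on four uniform machines.  The jobs are the vertices of a
finite graph `G` whose edges are the conflicts.  The machines `M_1, …, M_4` are indexed by `Fin 4`
(`M_1` is the index `0`), and `s i` is the speed of the machine `i`. -/

namespace FourMachines

open Finset

open scoped Classical in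
/-- The number of jobs that the assignment `σ` puts on the machine `i`. -/
noncomputable def load {V : Type*} [Fintype V] (σ : V → Fin 4) (i : Fin 4) : ℕ :=
  #{v : V | σ v = i}

/-- The length `C_max = max {load_i / s_i : i = 1, …, 4}` of the assignment `σ`. -/
noncomputable def length {V : Type*} [Fintype V] (s : Fin 4 → ℝ) (σ : V → Fin 4) : ℝ :=
  (univ : Finset (Fin 4)).sup' univ_nonempty fun i => (load σ i : ℝ) / s i

/-- A schedule: conflicting jobs are on different machines. -/
def IsSchedule {V : Type*} (G : SimpleGraph V) (σ : V → Fin 4) : Prop :=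
  ∀ u v, G.Adj u v → σ u ≠ σ v

/-- An optimal schedule: a schedule of minimum length among all schedules. -/
def IsOptimalSchedule {V : Type*} [Fintype V] (G : SimpleGraph V) (s : Fin 4 → ℝ)
    (σ : V → Fin 4) : Prop :=
  IsSchedule G σ ∧ ∀ τ : V → Fin 4, IsSchedule G τ → length s σ ≤ length s τ

/-- `A` and `B` are the two sides of a subgraph `K_{3,3}` of `G`. -/
def IsK33 {V : Type*} (G : SimpleGraph V) (A B : Finset V) : Prop :=
  #A = 3 ∧ #B = 3 ∧ ∀ a ∈ A, ∀ b ∈ B, G.Adj a b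

/-- `I` contains 6 vertices from the neighborhood of the `K_{3,3}` with sides `A` and `B`; the
neighborhood consists of the vertices outside `K_{3,3}` that have a neighbor in it. -/
def ContainsSixNeighbors {V : Type*} (G : SimpleGraph V) (I A B : Finset V) : Prop :=
  ∃ T ⊆ I, #T = 6 ∧ ∀ w ∈ T, w ∉ A ∧ w ∉ B ∧ ∃ x, (x ∈ A ∨ x ∈ B) ∧ G.Adj w x

/-- The graph `G - I`. -/
abbrev minus {V : Type*} (G : SimpleGraph V) (I : Finset V) : SimpleGraph {v // v ∉ I} :=
  G.comap Subtype.val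

/-- The number of vertices of color `i` in the connected component `K`. -/
noncomputable def sizeIn {W : Type*} {H : SimpleGraph W} (c : W → Fin 3)
    (K : H.ConnectedComponent) (i : Fin 3) : ℕ :=
  {w : W | w ∈ K.supp ∧ c w = i}.ncard

/-- `c` is a proper 3-coloring of `H` that is equitable on every connected component `K`:
the classes `A`, `B`, `C` of `K` satisfy `|A| ≤ |B| ≤ |C| ≤ |A| + 1`. -/
def ColorsComponentsEquitably {W : Type*} (H : SimpleGraph W) (c : W → Fin 3) : Prop :=
  (∀ u w, H.Adj u w → c u ≠ c w) ∧
    ∀ K : H.ConnectedComponent,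
      sizeIn c K 0 ≤ sizeIn c K 1 ∧ sizeIn c K 1 ≤ sizeIn c K 2 ∧
        sizeIn c K 2 ≤ sizeIn c K 0 + 1

/-- The three classes of `d` differ by at most one in size. -/
def HasEquitableClasses {W : Type*} (d : W → Fin 3) : Prop :=
  ∀ i j : Fin 3, {w : W | d w = i}.ncard ≤ {w : W | d w = j}.ncard + 1

/-- The coloring obtained from `c` by putting the class `i` of each component `K` into the
class `π K i` of the whole graph. -/
def combine {W : Type*} (H : SimpleGraph W) (c : W → Fin 3)
    (π : H.ConnectedComponent → Equiv.Perm (Fin 3)) : W → Fin 3 :=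
  fun w => π (H.connectedComponentMk w) (c w)

/-- The jobs in `I` go to `M_1`, and the classes of the coloring `d` of the other jobs
to `M_2`, `M_3`, `M_4`. -/
noncomputable def assign {V : Type*} (I : Finset V) (d : {v // v ∉ I} → Fin 3) : V → Fin 4 :=
  open scoped Classical in fun v => if h : v ∉ I then (d ⟨v, h⟩).succ else 0

/-- The states of the algorithm. -/
inductive State (V : Type*) : Type _
  /-- Nothing has been done. -/
  | start : State V
  /-- `I₀` is the set found first, and `I` is the current value of `I_1`. -/
  | selected (I₀ I : Finset V) : State V
  /-- The set `I₁` has been assigned to `M_1`. -/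
  | assigned (I₁ : Finset V) : State V
  /-- In addition, the components of `G - I₁` have been colored. -/
  | colored (I₁ : Finset V) (c : {v // v ∉ I₁} → Fin 3) : State V
  /-- The algorithm has returned `σ`. -/
  | done (σ : V → Fin 4) : State V

open scoped Classical in
/-- One step of the algorithm on the graph `G`.  The algorithm is nondeterministic: wherever it says
"find", every object with the required properties may be found. -/
inductive Step {V : Type*} [Fintype V] (G : SimpleGraph V) : State V → State V → Prop
  /-- Find a maximum independent set. -/
  | select (I : Finset V) (hI : G.IsMaximumIndepSet I) :
      Step G .start (.selected I I)
  /-- If `I_1` contains 6 vertices from the neighborhood of a `K_{3,3}`, interchange one of them,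
  `u`, with its neighbor `v` in this `K_{3,3}`.  Here `u` is in the set that was found first. -/
  | interchange (I₀ I A B : Finset V) (u v : V) (hK : IsK33 G A B)
      (hN : ContainsSixNeighbors G I A B) (hu : u ∈ I) (hu₀ : u ∈ I₀) (hv : v ∈ A ∨ v ∈ B)
      (huv : G.Adj u v) :
      Step G (.selected I₀ I) (.selected I₀ (insert v (I.erase u)))
  /-- When there is no such `K_{3,3}` (any more), assign `I_1` to `M_1`. -/
  | assign (I₀ I : Finset V)
      (h : ∀ A B : Finset V, IsK33 G A B → ¬ ContainsSixNeighbors G I A B) :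
      Step G (.selected I₀ I) (.assigned I)
  /-- Find an equitable 3-coloring of each component of `G - I_1`. -/
  | color (I : Finset V) (c : {v // v ∉ I} → Fin 3)
      (hc : ColorsComponentsEquitably (minus G I) c) :
      Step G (.assigned I) (.colored I c)
  /-- Combine these to an equitable coloring of `G - I_1`; assign its classes
  to `M_2`, `M_3`, `M_4`. -/
  | combine (I : Finset V) (c : {v // v ∉ I} → Fin 3)
      (π : (minus G I).ConnectedComponent → Equiv.Perm (Fin 3))
      (hd : HasEquitableClasses (combine (minus G I) c π)) :
      Step G (.colored I c) (.done (FourMachines.assign I (combine (minus G I) c π)))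

/-- A state that some run of the algorithm on `G` reaches. -/
def Reachable {V : Type*} [Fintype V] (G : SimpleGraph V) (q : State V) : Prop :=
  Relation.ReflTransGen (Step G) .start q

/-- Every run of the algorithm on `G` is finite. -/
def Terminates {V : Type*} [Fintype V] (G : SimpleGraph V) : Prop :=
  ¬ ∃ run : ℕ → State V, run 0 = .start ∧ ∀ k, Step G (run k) (run (k + 1))

/-- No run of the algorithm on `G` gets stuck before it has returned an assignment. -/
def NeverStuck {V : Type*} [Fintype V] (G : SimpleGraph V) : Prop :=
  ∀ q, Reachable G q → (∃ σ, q = .done σ) ∨ ∃ q', Step G q q'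

end FourMachines

/-! The argument has three parts.

*The interchanges.*  The vertices of a `K_{3,3}` have at most one neighbor outside it.  So six
neighbors in `I₁` are private neighbors of the six vertices, none of which is in `I₁`, and an
interchange again leads to a maximum independent set.  It removes a vertex of `I₀` and adds a vertex
that is not in `I₀`, so `|I₁ ∩ I₀|` decreases and there are finitely many interchanges.  If `I₁`
contains six neighbors of a `K_{3,3}`, some interchange is possible: otherwise there is a vertex
`b ∉ I₀` of the `K_{3,3}` whose private neighbor is not in `I₀` either, hence was added by an earlier
interchange, and the `K_{3,3}` of that interchange would overlap with the present one in an
impossible way (`exists_interchange`).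

*The colorings.*  As `I₁` is a maximum independent set, `G - I₁` has maximum degree at most 3.
It does not contain a `K_{3,3}`: if `I₁` does not contain six neighbors of it, then three vertices on
one of its sides have at most two neighbors in `I₁` and could replace them
(`containsSixNeighbors_of_forall_notMem`).  A connected bipartite graph of maximum degree at most 3
other than `K_{3,3}` has an equitable 3-coloring (`exists_sorted_equitable_coloring`): one class
consists of most of the smaller side `Y`, the remaining set `S ⊆ Y` is chosen with at most
`2 * |S| + 1` neighbors by adding vertices one by one along the connected graph, these neighbors are
put into a second class on the larger side, and what is left is the third class.  The bound has to be
improved by one if both sides have `3 * |S|` vertices (`exists_card_nbhd_le_two_mul`).  The colorings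
of the components are combined greedily (`exists_perm_sum_equitable`).

*Optimality.*  No schedule has more than `|I₁|` jobs on the first machine, so that the largest load
of the other machines is at least that of an equitable partition of the remaining jobs.  Counting
edges gives `|I₁| ≤ 4 * |V(G) - I₁|`, so a machine that is at least 12 times as fast as the others does
not finish later than the latest of them (`isOptimalSchedule_assign`). -/

namespace FourMachines

open Finset

/-! ### Equitable 3-colorings of connected bipartite graphs -/

section Connected

open scoped Classical in
/-- The set of all vertices that have a neighbor in `S`. -/
noncomputable def nbhd {W : Type*} [Fintype W] (H : SimpleGraph W) (S : Finset W) : Finset W :=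
  {z | ∃ y ∈ S, H.Adj y z}

/-- All degrees are at most `k`.  This form, unlike `SimpleGraph.degree`, needs neither finiteness
nor decidability of the neighborhoods, and it passes to subgraphs at once. -/
def DegreeLE {W : Type*} (H : SimpleGraph W) (k : ℕ) : Prop :=
  ∀ v, ∀ S : Finset W, (∀ z ∈ S, H.Adj v z) → #S ≤ k

/-- `Y` is one side of a bipartition of `H`; the other side is its complement. -/
def IsSide {W : Type*} (H : SimpleGraph W) (Y : Finset W) : Prop :=
  ∀ ⦃u w⦄, H.Adj u w → (u ∈ Y ↔ w ∉ Y)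

variable {W : Type*} [Fintype W] {H : SimpleGraph W} {Y S : Finset W}

@[simp] theorem mem_nbhd {z : W} : z ∈ nbhd H S ↔ ∃ y ∈ S, H.Adj y z := by
  simp [nbhd]

theorem card_nbhd_singleton_le {k : ℕ} (hd : DegreeLE H k) (y : W) : #(nbhd H {y}) ≤ k :=
  hd y _ fun z hz => by simpa using hz

open scoped Classical in
theorem IsSide.compl (hY : IsSide H Y) : IsSide H Yᶜ := fun u w h => by
  have := hY h
  simp only [mem_compl]
  tauto

open scoped Classical in
theorem IsSide.nbhd_subset (hY : IsSide H Y) (hS : S ⊆ Y) : nbhd H S ⊆ Yᶜ := fun z hz => by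
  obtain ⟨y, hy, hyz⟩ := mem_nbhd.1 hz
  exact mem_compl.2 ((hY hyz).1 (hS hy))

omit [Fintype W] in
/-- A set of vertices that is closed under adjacency and contains a vertex of a connected graph
contains all of them. -/
theorem mem_of_closed (hc : H.Preconnected) (P : W → Prop) (hP : ∀ u w, H.Adj u w → P u → P w)
    {a : W} (ha : P a) (b : W) : P b := by
  obtain ⟨p⟩ := hc a b
  induction p with
  | nil => exact ha
  | cons h p ih => exact ih (hP _ _ h ha)

/-- By connectedness, a nonempty proper subset of a side can be extended by a vertex that shares a
neighbor with it. -/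
theorem exists_common_neighbor (hc : H.Preconnected) (hY : IsSide H Y) (hS : S ⊆ Y)
    (hne : S.Nonempty) (hlt : #S < #Y) : ∃ y ∈ Y, y ∉ S ∧ ∃ z ∈ nbhd H S, H.Adj y z := by
  by_contra! hcon
  obtain ⟨s, hs⟩ := hne
  obtain ⟨y, hyY, hyS⟩ := exists_mem_notMem_of_card_lt_card hlt
  have key := mem_of_closed hc (fun w => w ∈ S ∨ w ∈ nbhd H S) (fun u w huw hu => by
    by_cases huS : u ∈ S
    · exact Or.inr (mem_nbhd.2 ⟨u, huS, huw⟩)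
    · have hu' := hu.resolve_left huS
      obtain ⟨t, ht, htu⟩ := mem_nbhd.1 hu'
      have h1 := hY huw
      have h2 := hY htu
      have h3 := hS ht
      by_contra hw
      push Not at hw
      exact hcon w (by tauto) hw.1 u hu' huw.symm) (Or.inl hs) y
  obtain ⟨t, ht, hty⟩ := mem_nbhd.1 (key.resolve_left hyS)
  exact (hY hty).1 (hS ht) hyY

open scoped Classical in
theorem card_nbhd_insert_le (y : W) :
    #(nbhd H (insert y S)) ≤ #(nbhd H S) + #(nbhd H {y} \ nbhd H S) := by
  refine (card_le_card ?_).trans (card_union_le _ _)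
  intro z hz
  simp only [mem_nbhd, mem_insert, mem_union, mem_sdiff, mem_singleton] at *
  grind

open scoped Classical in
theorem card_nbhd_insert_le_add_two (hd : DegreeLE H 3) {y z : W} (hz : z ∈ nbhd H S)
    (hyz : H.Adj y z) : #(nbhd H (insert y S)) ≤ #(nbhd H S) + 2 := by
  have h1 := card_nbhd_insert_le (H := H) (S := S) y
  have h2 : nbhd H {y} \ nbhd H S ⊂ nbhd H {y} :=
    ⟨sdiff_subset, fun h => (mem_sdiff.1 (h (by simpa using hyz))).2 hz⟩
  have h3 := card_lt_card h2
  have h4 := card_nbhd_singleton_le hd y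
  omega

/-- Adding one vertex at a time, each sharing a neighbor with the previous ones, gives subsets of
a side with few neighbors. -/
theorem exists_card_nbhd_le_of_start (hc : H.Preconnected) (hY : IsSide H Y) (hd : DegreeLE H 3)
    {y₀ : W} (hy₀ : y₀ ∈ Y) {d : ℕ} (hstart : #(nbhd H {y₀}) ≤ d) (k : ℕ) (hk : k + 1 ≤ #Y) :
    ∃ S ⊆ Y, #S = k + 1 ∧ #(nbhd H S) ≤ d + 2 * k := by
  classical
  induction k with
  | zero => exact ⟨{y₀}, by simpa using hy₀, by simp, by simpa using hstart⟩
  | succ k ih =>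
    obtain ⟨S, hS, hcard, hn⟩ := ih (by omega)
    obtain ⟨y, hyY, hyS, z, hz, hyz⟩ := exists_common_neighbor hc hY hS
      (card_pos.1 (by omega)) (by omega)
    refine ⟨insert y S, insert_subset hyY hS, by rw [card_insert_of_notMem hyS, hcard], ?_⟩
    have := card_nbhd_insert_le_add_two hd hz hyz
    omega

theorem exists_card_nbhd_le (hc : H.Preconnected) (hY : IsSide H Y) (hd : DegreeLE H 3)
    (k : ℕ) (hk : k ≤ #Y) : ∃ S ⊆ Y, #S = k ∧ #(nbhd H S) ≤ 2 * k + 1 := by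
  obtain _ | k := k
  · exact ⟨∅, by simp, by simp, by simp [nbhd]⟩
  · obtain ⟨y₀, hy₀⟩ : Y.Nonempty := card_pos.1 (by omega)
    obtain ⟨S, h1, h2, h3⟩ := exists_card_nbhd_le_of_start hc hY hd hy₀
      (card_nbhd_singleton_le hd y₀) k hk
    exact ⟨S, h1, h2, by omega⟩

open scoped Classical in
/-- The sides of a connected bipartite graph of maximum degree at most 3 are not too far apart
in size. -/
theorem card_compl_side_le (hc : H.Preconnected) (hY : IsSide H Y) (hd : DegreeLE H 3) :
    #Yᶜ ≤ 2 * #Y + 1 := by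
  have hnb : ∀ a b : W, a ≠ b → ∃ z, H.Adj a z := fun a b hab => by
    by_contra! h
    exact hab (mem_of_closed hc (fun w => a = w) (fun u w huw hu => by
      subst hu; exact absurd huw (h w)) rfl b)
  by_cases hY0 : Y = ∅
  · have : #Yᶜ ≤ 1 := card_le_one.2 fun a ha b hb => by
      by_contra hab
      obtain ⟨z, hz⟩ := hnb a b hab
      have := hY hz
      simp [hY0] at this
    omega
  · obtain ⟨y, hy⟩ := nonempty_iff_ne_empty.2 hY0
    obtain ⟨S, hS, hcard, hn⟩ := exists_card_nbhd_le hc hY hd #Y le_rfl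
    obtain rfl := eq_of_subset_of_card_le hS hcard.ge
    refine (card_le_card fun x hx => ?_).trans hn
    have hx' := mem_compl.1 hx
    obtain ⟨z, hz⟩ := hnb x y (by rintro rfl; exact hx' hy)
    have := hY hz
    exact mem_nbhd.2 ⟨z, by tauto, hz.symm⟩

open scoped Classical in
/-- Counting the edges between a set `S` of vertices on one side and a set `T` on the other. -/
theorem sum_card_nbhd_inter (S T : Finset W) :
    ∑ y ∈ S, #(nbhd H {y} ∩ T) = ∑ x ∈ T, #(nbhd H {x} ∩ S) := by
  have := sum_card_bipartiteAbove_eq_sum_card_bipartiteBelow (s := S) (t := T) H.Adj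
  convert this using 4 with y hy x hx
  · ext z; simp [bipartiteAbove, and_comm]
  · ext z; simp [bipartiteBelow, and_comm, H.adj_comm]

open scoped Classical in
/-- If both sides have `3 * b` vertices, the bound of `exists_card_nbhd_le` can be improved by one,
unless the graph is `K_{3,3}`.  This is clear if there is a vertex of degree at most 2 to start with.
In a cubic graph, if `b - 1` vertices have `2 * b - 1` neighbors, these send `3 * b` edges to the
remaining `2 * b + 1` vertices, so that one of them shares two neighbors with the given ones. -/
theorem exists_card_nbhd_le_two_mul (hc : H.Preconnected) (hY : IsSide H Y) (hd : DegreeLE H 3)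
    (hK : ∀ A B : Finset W, ¬ IsK33 H A B) {b : ℕ} (hb : 1 ≤ b) (hy : #Y = 3 * b)
    (hx : #Yᶜ = 3 * b) : ∃ S ⊆ Y, #S = b ∧ #(nbhd H S) ≤ 2 * b := by
  by_cases hlow : ∃ y ∈ Y, #(nbhd H {y}) ≤ 2
  · obtain ⟨y, hyY, h2⟩ := hlow
    obtain ⟨S, h1, h2, h3⟩ := exists_card_nbhd_le_of_start hc hY hd hyY h2 (b - 1) (by omega)
    exact ⟨S, h1, by omega, by omega⟩
  push Not at hlow
  have hdegY : ∀ y ∈ Y, #(nbhd H {y}) = 3 := fun y hyY =>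
    le_antisymm (card_nbhd_singleton_le hd y) (hlow y hyY)
  have hinterY : ∀ y ∈ Y, nbhd H {y} ∩ Yᶜ = nbhd H {y} := fun y hyY =>
    inter_eq_left.2 (hY.nbhd_subset (by simpa using hyY))
  have hinterX : ∀ x ∈ Yᶜ, nbhd H {x} ∩ Y = nbhd H {x} := fun x hx =>
    inter_eq_left.2 (by simpa using hY.compl.nbhd_subset (S := {x}) (by simpa using hx))
  have hdegX : ∀ x ∈ Yᶜ, #(nbhd H {x}) = 3 := by
    have hsum : ∑ x ∈ Yᶜ, #(nbhd H {x}) = ∑ x ∈ Yᶜ, 3 := by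
      calc ∑ x ∈ Yᶜ, #(nbhd H {x}) = ∑ x ∈ Yᶜ, #(nbhd H {x} ∩ Y) :=
            sum_congr rfl fun x hx => by rw [hinterX x hx]
        _ = ∑ y ∈ Y, #(nbhd H {y} ∩ Yᶜ) := (sum_card_nbhd_inter Y Yᶜ).symm
        _ = ∑ y ∈ Y, 3 := sum_congr rfl fun y hyY => by rw [hinterY y hyY, hdegY y hyY]
        _ = ∑ x ∈ Yᶜ, 3 := by simp [hx, hy]
    exact (sum_eq_sum_iff_of_le fun x _ => card_nbhd_singleton_le hd x).1 hsum
  obtain rfl | hb2 : b = 1 ∨ 2 ≤ b := by omega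
  · refine absurd ⟨hy, hx, fun y hyY x hxX => ?_⟩ (hK Y Yᶜ)
    have : nbhd H {y} = Yᶜ := eq_of_subset_of_card_le
      (hY.nbhd_subset (by simpa using hyY)) (by rw [hdegY y hyY, hx])
    rw [← this] at hxX
    simpa using hxX
  obtain ⟨S, hS, hScard, hSn⟩ := exists_card_nbhd_le hc hY hd (b - 1) (by omega)
  have hne : S.Nonempty := card_pos.1 (by omega)
  by_cases hsmall : #(nbhd H S) ≤ 2 * b - 2
  · obtain ⟨y, hyY, hyS, z, hz, hyz⟩ := exists_common_neighbor hc hY hS hne (by omega)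
    have := card_nbhd_insert_le_add_two hd hz hyz
    exact ⟨insert y S, insert_subset hyY hS, by rw [card_insert_of_notMem hyS]; omega, by omega⟩
  obtain ⟨y, hyY, hyS, hy2⟩ : ∃ y ∈ Y, y ∉ S ∧ 2 ≤ #(nbhd H {y} ∩ nbhd H S) := by
    by_contra! hcon
    have hNX := hY.nbhd_subset hS
    have hsum := sum_card_nbhd_inter (H := H) Y (nbhd H S)
    have h1 : ∑ x ∈ nbhd H S, #(nbhd H {x} ∩ Y) = #(nbhd H S) * 3 := by
      rw [sum_congr rfl fun x hx => by rw [hinterX x (hNX hx), hdegX x (hNX hx)]]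
      simp
    have h2 : ∑ y ∈ S, #(nbhd H {y} ∩ nbhd H S) ≤ #S * 3 :=
      sum_le_card_nsmul _ _ _ fun y _ =>
        (card_le_card inter_subset_left).trans (card_nbhd_singleton_le hd y)
    have h3 : ∑ y ∈ Y \ S, #(nbhd H {y} ∩ nbhd H S) ≤ #(Y \ S) * 1 :=
      sum_le_card_nsmul _ _ _ fun y hy => by
        have := hcon y (mem_sdiff.1 hy).1 (mem_sdiff.1 hy).2
        omega
    have h4 := sum_sdiff hS (f := fun y => #(nbhd H {y} ∩ nbhd H S))
    have h5 := card_sdiff_add_card_eq_card hS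
    omega
  refine ⟨insert y S, insert_subset hyY hS, by rw [card_insert_of_notMem hyS]; omega, ?_⟩
  have h1 := card_nbhd_insert_le (H := H) (S := S) y
  have h2 := card_sdiff_add_card_inter (nbhd H {y}) (nbhd H S)
  have h3 := card_nbhd_singleton_le hd y
  omega

open scoped Classical in
/-- A 3-coloring is obtained from a set `S` of vertices on one side `Y`: the classes are a set `P`
on the other side that contains all neighbors of `S`, the set `Y \ S`, and the rest. -/
theorem exists_coloring_of_subset (hY : IsSide H Y) (hS : S ⊆ Y) {p : ℕ} (hp : #(nbhd H S) ≤ p)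
    (hpX : p ≤ #Yᶜ) (h01 : p ≤ #Y - #S + 1 ∧ #Y - #S ≤ p + 1)
    (h02 : p ≤ #Yᶜ - p + #S + 1 ∧ #Yᶜ - p + #S ≤ p + 1)
    (h12 : #Y - #S ≤ #Yᶜ - p + #S + 1 ∧ #Yᶜ - p + #S ≤ #Y - #S + 1) :
    ∃ c : W → Fin 3, (∀ u w, H.Adj u w → c u ≠ c w) ∧
      ∀ i j, #{w | c w = i} ≤ #{w | c w = j} + 1 := by
  obtain ⟨P, hNP, hPX, hPcard⟩ := exists_subsuperset_card_eq (hY.nbhd_subset hS) hp hpX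
  refine ⟨fun w => if w ∈ P then 0 else if w ∈ Y \ S then 1 else 2, fun u w huw => ?_, ?_⟩
  · have h1 := hY huw
    have h2 : u ∈ S → w ∈ P := fun h => hNP (mem_nbhd.2 ⟨u, h, huw⟩)
    have h3 : w ∈ S → u ∈ P := fun h => hNP (mem_nbhd.2 ⟨w, h, huw.symm⟩)
    have h4 : u ∈ P → u ∉ Y := fun h => mem_compl.1 (hPX h)
    have h5 : w ∈ P → w ∉ Y := fun h => mem_compl.1 (hPX h)
    simp only [mem_sdiff]
    split_ifs <;> simp <;> tauto
  · have hd : ∀ w ∈ P, w ∉ Y := fun w h => mem_compl.1 (hPX h)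
    have e0 : ({w | (if w ∈ P then (0 : Fin 3) else if w ∈ Y \ S then 1 else 2) = 0} : Finset W)
        = P := by
      ext w; simp only [mem_filter, mem_univ, true_and]; split_ifs <;> simp_all
    have e1 : ({w | (if w ∈ P then (0 : Fin 3) else if w ∈ Y \ S then 1 else 2) = 1} : Finset W)
        = Y \ S := by
      ext w; simp only [mem_filter, mem_univ, true_and]
      have := hd w
      split_ifs <;> simp_all
    have e2 : ({w | (if w ∈ P then (0 : Fin 3) else if w ∈ Y \ S then 1 else 2) = 2} : Finset W)
        = (Yᶜ \ P) ∪ S := by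
      ext w; simp only [mem_filter, mem_univ, true_and, mem_union, mem_sdiff, mem_compl]
      have := hd w
      have := @hS w
      split_ifs <;> simp <;> tauto
    have c1 : #(Y \ S) = #Y - #S := card_sdiff_of_subset hS
    have c2 : #((Yᶜ \ P) ∪ S) = #Yᶜ - p + #S := by
      rw [card_union_of_disjoint, card_sdiff_of_subset hPX, hPcard]
      exact disjoint_left.2 fun w hw hwS => mem_compl.1 (mem_sdiff.1 hw).1 (hS hwS)
    intro i j
    fin_cases i <;> fin_cases j <;> simp only [Fin.zero_eta, Fin.mk_one, Fin.reduceFinMk] <;>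
      simp only [e0, e1, e2, c1, c2, hPcard] <;> omega

open scoped Classical in
theorem exists_equitable_coloring_of_side (hc : H.Preconnected) (hY : IsSide H Y)
    (hd : DegreeLE H 3) (hK : ∀ A B : Finset W, ¬ IsK33 H A B) (hle : #Y ≤ #Yᶜ) :
    ∃ c : W → Fin 3, (∀ u w, H.Adj u w → c u ≠ c w) ∧
      ∀ i j, #{w | c w = i} ≤ #{w | c w = j} + 1 := by
  have hX := card_compl_side_le hc hY hd
  by_cases hbig : 2 * #Y ≤ #Yᶜ + 1
  -- The larger side is split into two classes.
  · exact exists_coloring_of_subset (S := ∅) (p := #Y) hY (by simp) (by simp [nbhd]) hle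
      (by simp) (by simp; omega) (by simp; omega)
  obtain ⟨p, hp | hp | hp⟩ : ∃ p, #Y + #Yᶜ = 3 * p ∨ #Y + #Yᶜ = 3 * p + 1 ∨
      #Y + #Yᶜ = 3 * p + 2 := ⟨(#Y + #Yᶜ) / 3, by omega⟩
  · by_cases heq : #Y = #Yᶜ
    · obtain ⟨S, hS, hcard, hn⟩ := exists_card_nbhd_le_two_mul hc hY hd hK (b := #Y - p)
        (by omega) (by omega) (by omega)
      exact exists_coloring_of_subset (p := p) hY hS (by omega) (by omega)
        (by omega) (by omega) (by omega)
    · obtain ⟨S, hS, hcard, hn⟩ := exists_card_nbhd_le hc hY hd (#Y - p) (by omega)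
      exact exists_coloring_of_subset (p := p) hY hS (by omega) (by omega)
        (by omega) (by omega) (by omega)
  -- The larger class may have to lie on the smaller side.
  · by_cases hb : 2 * (#Y - p) ≤ p
    · obtain ⟨S, hS, hcard, hn⟩ := exists_card_nbhd_le hc hY hd (#Y - p) (by omega)
      exact exists_coloring_of_subset (p := p + 1) hY hS (by omega) (by omega)
        (by omega) (by omega) (by omega)
    · obtain ⟨S, hS, hcard, hn⟩ := exists_card_nbhd_le hc hY hd (#Y - (p + 1)) (by omega)
      exact exists_coloring_of_subset (p := p) hY hS (by omega) (by omega)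
        (by omega) (by omega) (by omega)
  · obtain ⟨S, hS, hcard, hn⟩ := exists_card_nbhd_le hc hY hd (#Y - (p + 1)) (by omega)
    exact exists_coloring_of_subset (p := p + 1) hY hS (by omega) (by omega)
      (by omega) (by omega) (by omega)

open scoped Classical in
/-- A connected bipartite graph of maximum degree at most 3 other than `K_{3,3}` has an equitable
3-coloring; its classes may be numbered by increasing size. -/
theorem exists_sorted_equitable_coloring (hc : H.Preconnected) (hbip : H.IsBipartite)
    (hd : DegreeLE H 3) (hK : ∀ A B : Finset W, ¬ IsK33 H A B) :
    ∃ c : W → Fin 3, (∀ u w, H.Adj u w → c u ≠ c w) ∧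
      #{w | c w = 0} ≤ #{w | c w = 1} ∧ #{w | c w = 1} ≤ #{w | c w = 2} ∧
        #{w | c w = 2} ≤ #{w | c w = 0} + 1 := by
  obtain ⟨f⟩ := hbip
  have hY : IsSide H ({w | f w = 0} : Finset W) := fun u w huw => by
    have := f.valid huw
    simp only [mem_filter, mem_univ, true_and]
    omega
  obtain ⟨c, hc1, hc2⟩ : ∃ c : W → Fin 3, (∀ u w, H.Adj u w → c u ≠ c w) ∧
      ∀ i j, #{w | c w = i} ≤ #{w | c w = j} + 1 := by
    rcases le_total #({w | f w = 0} : Finset W) #({w | f w = 0} : Finset W)ᶜ with h | h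
    · exact exists_equitable_coloring_of_side hc hY hd hK h
    · exact exists_equitable_coloring_of_side hc hY.compl hd hK (by rwa [compl_compl])
  let τ := Tuple.sort fun i => #{w | c w = i}
  have hτ : Monotone ((fun i => #{w | c w = i}) ∘ τ) := Tuple.monotone_sort _
  refine ⟨fun w => τ.symm (c w), fun u w huw h => hc1 u w huw (τ.symm.injective h), ?_⟩
  simp only [Equiv.symm_apply_eq]
  exact ⟨hτ (by decide : (0 : Fin 3) ≤ 1), hτ (by decide : (1 : Fin 3) ≤ 2), hc2 _ _⟩

end Connected

/-! ### Coloring the components and combining the colorings -/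

section Components

theorem DegreeLE.comap {V W : Type*} {G : SimpleGraph V} {H : SimpleGraph W} {k : ℕ}
    (hd : DegreeLE G k) (f : W ↪ V) (hf : ∀ u w, H.Adj u w → G.Adj (f u) (f w)) :
    DegreeLE H k := fun v S hS => by
  rw [← card_map f]
  exact hd (f v) _ fun z hz => by
    obtain ⟨w, hw, rfl⟩ := mem_map.1 hz
    exact hf _ _ (hS w hw)

theorem IsK33.map {V W : Type*} {G : SimpleGraph V} {H : SimpleGraph W} {A B : Finset W}
    (h : IsK33 H A B) (f : W ↪ V) (hf : ∀ u w, H.Adj u w → G.Adj (f u) (f w)) :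
    IsK33 G (A.map f) (B.map f) := by
  refine ⟨by simpa using h.1, by simpa using h.2.1, fun a ha b hb => ?_⟩
  obtain ⟨a', ha', rfl⟩ := mem_map.1 ha
  obtain ⟨b', hb', rfl⟩ := mem_map.1 hb
  exact hf _ _ (h.2.2 a' ha' b' hb')

theorem exists_colorsComponentsEquitably {W : Type*} [Fintype W] {H : SimpleGraph W}
    (hbip : H.IsBipartite) (hd : DegreeLE H 3) (hK : ∀ A B : Finset W, ¬ IsK33 H A B) :
    ∃ c, ColorsComponentsEquitably H c := by
  classical
  have key : ∀ K : H.ConnectedComponent, ∃ c : K.supp → Fin 3,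
      (∀ u w, (H.induce K.supp).Adj u w → c u ≠ c w) ∧
      #{w | c w = 0} ≤ #{w | c w = 1} ∧ #{w | c w = 1} ≤ #{w | c w = 2} ∧
        #{w | c w = 2} ≤ #{w | c w = 0} + 1 := fun K =>
    exists_sorted_equitable_coloring K.connected_toSimpleGraph.preconnected
      (hbip.of_hom (SimpleGraph.Embedding.induce K.supp).toHom)
      (hd.comap (Function.Embedding.subtype _) fun _ _ h => h)
      fun A B h => hK _ _ (h.map (Function.Embedding.subtype _) fun _ _ h => h)
  choose c hc hsize using key
  let d : W → Fin 3 := fun w => c (H.connectedComponentMk w) ⟨w, rfl⟩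
  have hd : ∀ (K : H.ConnectedComponent) (w : W) (hw : w ∈ K.supp), d w = c K ⟨w, hw⟩ := by
    rintro K w rfl
    rfl
  have hs : ∀ K i, sizeIn d K i = #{w | c K w = i} := fun K i => by
    rw [sizeIn, ← Set.ncard_coe_finset,
      ← Set.ncard_image_of_injective _ (Subtype.val_injective (p := fun w => w ∈ K.supp))]
    congr 1
    ext w
    simp only [Set.mem_ofPred_eq, coe_filter, mem_univ, true_and, Set.mem_image, Subtype.exists,
      exists_and_right, exists_eq_right]
    exact ⟨fun ⟨h1, h2⟩ => ⟨h1, (hd K w h1).symm.trans h2⟩,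
      fun ⟨h1, h2⟩ => ⟨h1, (hd K w h1).trans h2⟩⟩
  refine ⟨d, fun u w huw => ?_, fun K => by simpa only [hs] using hsize K⟩
  have hw : w ∈ (H.connectedComponentMk u).supp :=
    (SimpleGraph.ConnectedComponent.connectedComponentMk_eq_of_adj huw).symm
  rw [hd _ u rfl, hd _ w hw]
  exact hc _ _ _ huw

/-- Increasing triples with spread at most one can be permuted such that their sum has spread at
most one: the next triple is added in increasing order to the sum in decreasing order. -/
theorem exists_perm_sum_equitable {ι : Type*} (s : Finset ι) (f : ι → Fin 3 → ℕ)
    (hf : ∀ k, f k 0 ≤ f k 1 ∧ f k 1 ≤ f k 2 ∧ f k 2 ≤ f k 0 + 1) :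
    ∃ π : ι → Equiv.Perm (Fin 3), ∀ i j,
      ∑ k ∈ s, f k ((π k).symm i) ≤ ∑ k ∈ s, f k ((π k).symm j) + 1 := by
  classical
  induction s using Finset.induction_on with
  | empty => exact ⟨fun _ => 1, by simp⟩
  | insert a s ha ih =>
    obtain ⟨π, hπ⟩ := ih
    set g : Fin 3 → ℕ := fun i => ∑ k ∈ s, f k ((π k).symm i) with hg
    let τ := Fin.revPerm.trans (Tuple.sort g)
    have hm : Monotone (g ∘ Tuple.sort g) := Tuple.monotone_sort g
    have h01 : g (τ 1) ≤ g (τ 0) := hm (by decide : Fin.rev (1 : Fin 3) ≤ Fin.rev 0)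
    have h12 : g (τ 2) ≤ g (τ 1) := hm (by decide : Fin.rev (2 : Fin 3) ≤ Fin.rev 1)
    have h20 : g (τ 0) ≤ g (τ 2) + 1 := hπ _ _
    have hfa := hf a
    refine ⟨Function.update π a τ, ?_⟩
    have hsum : ∀ i, ∑ k ∈ insert a s, f k ((Function.update π a τ k).symm i) =
        f a (τ.symm i) + g i := fun i => by
      rw [sum_insert ha, Function.update_self]
      congr 1
      exact sum_congr rfl fun k hk => by
        rw [Function.update_of_ne (by rintro rfl; exact ha hk)]
    simp only [hsum]
    have key : ∀ i j, f a i + g (τ i) ≤ f a j + g (τ j) + 1 := by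
      intro i j
      fin_cases i <;> fin_cases j <;>
        simp only [Fin.zero_eta, Fin.mk_one, Fin.reduceFinMk] <;> omega
    exact fun i j => by simpa using key (τ.symm i) (τ.symm j)

theorem exists_hasEquitableClasses {W : Type*} [Fintype W] {H : SimpleGraph W} {c : W → Fin 3}
    (hc : ColorsComponentsEquitably H c) : ∃ π, HasEquitableClasses (combine H c π) := by
  classical
  obtain ⟨π, hπ⟩ := exists_perm_sum_equitable univ (fun K => sizeIn c K) hc.2
  refine ⟨π, ?_⟩
  have key : ∀ i, {w : W | combine H c π w = i}.ncard =
      ∑ K, sizeIn c K ((π K).symm i) := fun i => by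
    rw [← coe_filter_univ, Set.ncard_coe_finset,
      card_eq_sum_card_fiberwise (f := H.connectedComponentMk) (t := univ) (by simp)]
    refine sum_congr rfl fun K _ => ?_
    rw [sizeIn, ← coe_filter_univ, Set.ncard_coe_finset]
    congr 1
    ext w
    simp only [mem_filter, mem_univ, true_and,
      SimpleGraph.ConnectedComponent.mem_supp_iff, Equiv.eq_symm_apply]
    constructor
    · rintro ⟨h, rfl⟩; exact ⟨rfl, h⟩
    · rintro ⟨rfl, h⟩; exact ⟨h, rfl⟩
  exact fun i j => by simpa only [key] using hπ i j

theorem combine_ne_of_adj {W : Type*} {H : SimpleGraph W} {c : W → Fin 3}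
    (hc : ColorsComponentsEquitably H c) (π : H.ConnectedComponent → Equiv.Perm (Fin 3))
    {u w : W} (huw : H.Adj u w) : combine H c π u ≠ combine H c π w := by
  rw [combine, combine, SimpleGraph.ConnectedComponent.connectedComponentMk_eq_of_adj huw]
  exact fun h => hc.1 u w huw ((π _).injective h)

end Components

/-! ### Neighbors of a `K_{3,3}` in an independent set -/

section K33

variable {V : Type*} {G : SimpleGraph V} {A B I I₀ : Finset V}

theorem IsK33.symm (h : IsK33 G A B) : IsK33 G B A :=
  ⟨h.2.1, h.1, fun b hb a ha => (h.2.2 a ha b hb).symm⟩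

theorem IsK33.notMem_right (h : IsK33 G A B) {a : V} (ha : a ∈ A) : a ∉ B :=
  fun hb => G.loopless.irrefl a (h.2.2 a ha a hb)

/-- As three of the at most four neighbors of a vertex of a `K_{3,3}` are in the `K_{3,3}`, there is
at most one other neighbor. -/
theorem IsK33.eq_of_adj (hd : DegreeLE G 4) (h : IsK33 G A B) {x w w' : V} (hx : x ∈ A)
    (hw : G.Adj w x) (hw' : G.Adj w' x) (hwB : w ∉ B) (hwB' : w' ∉ B) : w = w' := by
  classical
  by_contra hne
  have h1 := hd x (insert w (insert w' B)) fun z hz => by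
    simp only [mem_insert] at hz
    rcases hz with rfl | rfl | hz
    · exact hw.symm
    · exact hw'.symm
    · exact h.2.2 x hx z hz
  rw [card_insert_of_notMem (by simp [hne, hwB]), card_insert_of_notMem hwB', h.2.1] at h1
  omega

theorem IsK33.eq_of_adj_of_mem (hd : DegreeLE G 4) (h : IsK33 G A B) {x w w' : V}
    (hx : x ∈ A ∨ x ∈ B) (hw : G.Adj w x) (hw' : G.Adj w' x) (hwK : w ∉ A ∧ w ∉ B)
    (hwK' : w' ∉ A ∧ w' ∉ B) : w = w' :=
  hx.elim (fun hx => h.eq_of_adj hd hx hw hw' hwK.2 hwK'.2)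
    fun hx => h.symm.eq_of_adj hd hx hw hw' hwK.1 hwK'.1

/-- If `I` contains six vertices from the neighborhood of a `K_{3,3}`, then each vertex of the
`K_{3,3}` has a private neighbor among these. -/
theorem ContainsSixNeighbors.exists_private (hN : ContainsSixNeighbors G I A B)
    (hd : DegreeLE G 4) (h : IsK33 G A B) {x : V} (hx : x ∈ A ∨ x ∈ B) :
    ∃ w ∈ I, (w ∉ A ∧ w ∉ B) ∧ G.Adj w x ∧ ∀ y, y ∈ A ∨ y ∈ B → G.Adj w y → y = x := by
  classical
  obtain ⟨T, hTI, hT6, hT⟩ := hN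
  have : ∀ w, ∃ y, w ∈ T → (y ∈ A ∨ y ∈ B) ∧ G.Adj w y := fun w => by
    by_cases hw : w ∈ T
    · obtain ⟨y, hy⟩ := (hT w hw).2.2
      exact ⟨y, fun _ => hy⟩
    · exact ⟨w, fun h => absurd h hw⟩
  choose f hf using this
  have hK : ∀ w ∈ T, w ∉ A ∧ w ∉ B := fun w hw => ⟨(hT w hw).1, (hT w hw).2.1⟩
  have hinj : Set.InjOn f T := fun w hw w' hw' he =>
    h.eq_of_adj_of_mem hd (hf w hw).1 (hf w hw).2 (he ▸ (hf w' hw').2) (hK w hw) (hK w' hw')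
  have himage : T.image f = A ∪ B := by
    refine eq_of_subset_of_card_le (fun y hy => ?_) ?_
    · obtain ⟨w, hw, rfl⟩ := mem_image.1 hy
      exact mem_union.2 (hf w hw).1
    · rw [card_image_of_injOn hinj, hT6]
      have := card_union_le A B
      have := h.1
      have := h.2.1
      omega
  have hsurj : ∀ y, y ∈ A ∨ y ∈ B → ∃ w ∈ T, f w = y := fun y hy =>
    mem_image.1 (himage ▸ mem_union.2 hy)
  obtain ⟨w, hw, rfl⟩ := hsurj x hx
  refine ⟨w, hTI hw, hK w hw, (hf w hw).2, fun y hy hwy => ?_⟩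
  obtain ⟨w', hw', rfl⟩ := hsurj y hy
  rw [h.eq_of_adj_of_mem hd hy hwy (hf w' hw').2 (hK w hw) (hK w' hw')]

theorem ContainsSixNeighbors.notMem (hN : ContainsSixNeighbors G I A B) (hd : DegreeLE G 4)
    (h : IsK33 G A B) (hI : G.IsIndepSet I) {x : V} (hx : x ∈ A ∨ x ∈ B) : x ∉ I := fun hxI => by
  obtain ⟨w, hw, -, hwx, -⟩ := hN.exists_private hd h hx
  exact hI hw hxI hwx.ne hwx

/-- Each vertex of `I` that is not in `I₀` is in a `K_{3,3}` such that its neighbors outside this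
`K_{3,3}` are in `I₀`: it has been interchanged with its only such neighbor. -/
def NewVerticesInK33 (G : SimpleGraph V) (I₀ I : Finset V) : Prop :=
  ∀ w ∈ I, w ∉ I₀ → ∃ A B, IsK33 G A B ∧ w ∈ A ∧ ∀ z, G.Adj w z → z ∉ B → z ∈ I₀

/-- The private neighbor `w` of a vertex `b ∉ I₀` of a `K_{3,3}` is in `I₀`.  Otherwise, `w` and `b`
are in a second `K_{3,3}`.  The side of `w` contains two vertices of `A`, whose only common
neighbors are those in `B`; so the other side is `B`, and `w` is adjacent to all of `B`. -/
theorem exists_mem_of_disjoint (hd : DegreeLE G 4) (hnew : NewVerticesInK33 G I₀ I)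
    (h : IsK33 G A B) (hN : ContainsSixNeighbors G I A B) (hdisj : ∀ b ∈ B, b ∉ I₀) :
    ∃ v u, (v ∈ A ∨ v ∈ B) ∧ u ∈ I ∧ u ∈ I₀ ∧ G.Adj u v := by
  classical
  have hB3 := h.2.1
  obtain ⟨b, hb, b', hb', hbb'⟩ := one_lt_card.1 (by omega : 1 < #B)
  obtain ⟨w, hwI, hwK, hwb, hpriv⟩ := hN.exists_private hd h (Or.inr hb)
  by_contra! hcon
  obtain ⟨C, D, hCD, hwC, hout⟩ := hnew w hwI fun hw₀ => hcon b w (Or.inr hb) hwI hw₀ hwb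
  have hbD : b ∈ D := by
    by_contra hbD
    exact hdisj b hb (hout b hwb hbD)
  have hCA : C.erase w ⊆ A := fun c hc => by
    by_contra hcA
    exact (mem_erase.1 hc).1 (h.symm.eq_of_adj hd hb (hCD.2.2 c (mem_erase.1 hc).2 b hbD) hwb
      hcA hwK.1)
  have hC2 : #(C.erase w) = 2 := by rw [card_erase_of_mem hwC, hCD.1]
  obtain ⟨a, ha, a', ha', haa'⟩ := one_lt_card.1 (by omega : 1 < #(C.erase w))
  have hDB : D ⊆ B := fun d hdD => by
    by_contra hdB
    have hda := hCD.2.2 a (mem_erase.1 ha).2 d hdD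
    have hda' := hCD.2.2 a' (mem_erase.1 ha').2 d hdD
    obtain ⟨p, -, hpK, hpa, hp⟩ := hN.exists_private hd h (Or.inl (hCA ha))
    obtain rfl := h.eq_of_adj hd (hCA ha) hpa hda.symm hpK.2 hdB
    exact haa' (hp a' (Or.inl (hCA ha')) hda'.symm).symm
  obtain rfl := eq_of_subset_of_card_le hDB (by rw [h.2.1, hCD.2.1])
  exact hbb' (hpriv b' (Or.inr hb') (hCD.2.2 w hwC b' hb')).symm

theorem exists_interchange (hd : DegreeLE G 4) (hI₀ : G.IsIndepSet I₀)
    (hnew : NewVerticesInK33 G I₀ I) (h : IsK33 G A B) (hN : ContainsSixNeighbors G I A B) :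
    ∃ v u, (v ∈ A ∨ v ∈ B) ∧ u ∈ I ∧ u ∈ I₀ ∧ G.Adj u v := by
  by_cases hB : ∀ b ∈ B, b ∉ I₀
  · exact exists_mem_of_disjoint hd hnew h hN hB
  · push Not at hB
    obtain ⟨b, hb, hbI⟩ := hB
    obtain ⟨T, h1, h2, h3⟩ := hN
    obtain ⟨v, u, hv, hu⟩ := exists_mem_of_disjoint hd hnew h.symm
      ⟨T, h1, h2, fun w hw => ⟨(h3 w hw).2.1, (h3 w hw).1, by simpa only [or_comm] using
        (h3 w hw).2.2⟩⟩
      fun a ha haI => hI₀ haI hbI (h.2.2 a ha b hb).ne (h.2.2 a ha b hb)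
    exact ⟨v, u, hv.symm, hu⟩

section Interchange

variable [DecidableEq V] {u v : V}

theorem isMaximumIndepSet_interchange [Fintype V] (hd : DegreeLE G 4) (hI : G.IsMaximumIndepSet I)
    (h : IsK33 G A B) (hN : ContainsSixNeighbors G I A B) (hu : u ∈ I) (hv : v ∈ A ∨ v ∈ B)
    (huv : G.Adj u v) : G.IsMaximumIndepSet (insert v (I.erase u)) := by
  have hnK : ∀ w ∈ I, w ∉ A ∧ w ∉ B := fun w hw =>
    ⟨fun hA => hN.notMem hd h hI.isIndepSet (Or.inl hA) hw,
      fun hB => hN.notMem hd h hI.isIndepSet (Or.inr hB) hw⟩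
  have hvI : v ∉ I := hN.notMem hd h hI.isIndepSet hv
  refine ⟨?_, fun t ht => ?_⟩
  · rw [coe_insert]
    refine (hI.isIndepSet.mono (by simp)).insert fun w hw _ => ?_
    obtain ⟨hwu, hwI⟩ := mem_erase.1 (mem_coe.1 hw)
    have : ¬ G.Adj w v := fun hwv =>
      hwu (h.eq_of_adj_of_mem hd hv hwv huv (hnK w hwI) (hnK u hu))
    exact ⟨fun h => this h.symm, this⟩
  · rw [card_insert_of_notMem (fun h => hvI (mem_erase.1 h).2), card_erase_add_one hu]
    exact hI.maximum t ht

theorem newVerticesInK33_interchange (hd : DegreeLE G 4) (hI : G.IsIndepSet I)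
    (hnew : NewVerticesInK33 G I₀ I) (h : IsK33 G A B) (hN : ContainsSixNeighbors G I A B)
    (hu : u ∈ I) (hu₀ : u ∈ I₀) (hv : v ∈ A ∨ v ∈ B) (huv : G.Adj u v) :
    NewVerticesInK33 G I₀ (insert v (I.erase u)) := by
  intro w hw hw₀
  rcases mem_insert.1 hw with rfl | hw
  · have huA : u ∉ A := fun hA => hN.notMem hd h hI (Or.inl hA) hu
    have huB : u ∉ B := fun hB => hN.notMem hd h hI (Or.inr hB) hu
    rcases hv with hv | hv
    · exact ⟨A, B, h, hv, fun z hz hzB => h.eq_of_adj hd hv huv hz.symm huB hzB ▸ hu₀⟩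
    · exact ⟨B, A, h.symm, hv, fun z hz hzA => h.symm.eq_of_adj hd hv huv hz.symm huA hzA ▸ hu₀⟩
  · exact hnew w (mem_erase.1 hw).2 hw₀

/-- The vertex `v` is not in `I₀`, since its neighbor `u` is. -/
theorem card_inter_interchange_lt (hI₀ : G.IsIndepSet I₀) (hu : u ∈ I) (hu₀ : u ∈ I₀)
    (huv : G.Adj u v) : #(insert v (I.erase u) ∩ I₀) < #(I ∩ I₀) := by
  have hv₀ : v ∉ I₀ := fun hv₀ => hI₀ hu₀ hv₀ huv.ne huv
  rw [insert_inter_of_notMem hv₀]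
  refine card_lt_card ⟨inter_subset_inter_right (erase_subset _ _), fun hsub => ?_⟩
  exact notMem_erase u I (mem_inter.1 (hsub (mem_inter.2 ⟨hu, hu₀⟩))).1

end Interchange

/-! ### The graph without a maximum independent set -/

theorem not_adj_of_common_neighbor (hG : G.IsBipartite) {a b c : V} (hca : G.Adj c a)
    (hcb : G.Adj c b) : ¬ G.Adj a b := fun hab => by
  obtain ⟨f⟩ := hG
  have h1 := f.valid hca
  have h2 := f.valid hcb
  have h3 := f.valid hab
  omega

variable [Fintype V]

theorem exists_adj_of_notMem (hI : G.IsMaximumIndepSet I) {v : V} (hv : v ∉ I) :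
    ∃ w ∈ I, G.Adj w v := by
  classical
  by_contra! hcon
  have := hI.maximum (insert v I) (by
    rw [coe_insert]
    exact hI.isIndepSet.insert fun w hw _ => ⟨fun h => hcon w hw h.symm, hcon w hw⟩)
  rw [card_insert_of_notMem hv] at this
  omega

theorem degreeLE_minus (hd : DegreeLE G 4) (hI : G.IsMaximumIndepSet I) :
    DegreeLE (minus G I) 3 := fun v S hS => by
  classical
  obtain ⟨w, hw, hwv⟩ := exists_adj_of_notMem hI v.2
  have h1 := hd v (insert w (S.map (Function.Embedding.subtype _))) fun z hz => by
    rcases mem_insert.1 hz with rfl | hz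
    · exact hwv.symm
    · obtain ⟨y, hy, rfl⟩ := mem_map.1 hz
      exact hS y hy
  rw [card_insert_of_notMem, card_map] at h1
  · omega
  · intro hmem
    obtain ⟨z, -, rfl⟩ := mem_map.1 hmem
    exact z.2 hw

/-- Two vertices on one side `A` of a `K_{3,3}` in `G - I` have no common neighbor in `I`, since
otherwise, `A` could replace its at most two neighbors in `I`. -/
theorem eq_of_common_neighbor (hG : G.IsBipartite) (hd : DegreeLE G 4)
    (hI : G.IsMaximumIndepSet I) (h : IsK33 G A B) (hA : ∀ a ∈ A, a ∉ I) (hB : ∀ b ∈ B, b ∉ I)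
    {x y w : V} (hx : x ∈ A) (hy : y ∈ A) (hw : w ∈ I) (hwx : G.Adj w x) (hwy : G.Adj w y) :
    x = y := by
  classical
  by_contra hxy
  have hg : ∀ a, ∃ z, a ∈ A → z ∈ I ∧ G.Adj z a := fun a => by
    by_cases ha : a ∈ A
    · obtain ⟨z, hz⟩ := exists_adj_of_notMem hI (hA a ha)
      exact ⟨z, fun _ => hz⟩
    · exact ⟨a, fun h => absurd h ha⟩
  choose g hg using hg
  have hnB : ∀ z ∈ I, z ∉ B := fun z hz hzB => hB z hzB hz
  let R : Finset V := {z ∈ I | ∃ a ∈ A, G.Adj z a}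
  have hRI : R ⊆ I := filter_subset _ _
  have hR : R ⊆ (A.erase y).image g := fun z hz => by
    obtain ⟨hzI, a, ha, hza⟩ := mem_filter.1 hz
    by_cases hay : a = y
    · subst hay
      refine mem_image.2 ⟨x, mem_erase.2 ⟨hxy, hx⟩, ?_⟩
      rw [h.eq_of_adj hd ha hza hwy (hnB z hzI) (hnB w hw)]
      exact h.eq_of_adj hd hx (hg x hx).2 hwx (hnB _ (hg x hx).1) (hnB w hw)
    · exact mem_image.2 ⟨a, mem_erase.2 ⟨hay, ha⟩,
        h.eq_of_adj hd ha (hg a ha).2 hza (hnB _ (hg a ha).1) (hnB z hzI)⟩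
  have hRcard : #R ≤ 2 := by
    refine (card_le_card hR).trans (card_image_le.trans ?_)
    rw [card_erase_of_mem hy, h.1]
  obtain ⟨b, hb⟩ : B.Nonempty := card_pos.1 (by rw [h.2.1]; omega)
  have hmax := hI.maximum ((I \ R) ∪ A) fun p hp q hq hpq => by
    have hIR : ∀ p ∈ I \ R, ∀ a ∈ A, ¬ G.Adj p a := fun p hp a ha hpa =>
      (mem_sdiff.1 hp).2 (mem_filter.2 ⟨(mem_sdiff.1 hp).1, a, ha, hpa⟩)
    rcases mem_union.1 (mem_coe.1 hp) with hp | hp <;>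
      rcases mem_union.1 (mem_coe.1 hq) with hq | hq
    · exact hI.isIndepSet (mem_sdiff.1 hp).1 (mem_sdiff.1 hq).1 hpq
    · exact hIR p hp q hq
    · exact fun hadj => hIR q hq p hp hadj.symm
    · exact not_adj_of_common_neighbor hG (h.2.2 p hp b hb).symm (h.2.2 q hq b hb).symm
  have hdisj : Disjoint (I \ R) A := disjoint_left.2 fun p hp hpA => hA p hpA (mem_sdiff.1 hp).1
  rw [card_union_of_disjoint hdisj, card_sdiff_of_subset hRI, h.1] at hmax
  have : #R ≤ #I := card_le_card hRI
  omega

theorem containsSixNeighbors_of_forall_notMem (hG : G.IsBipartite) (hd : DegreeLE G 4)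
    (hI : G.IsMaximumIndepSet I) (h : IsK33 G A B) (hA : ∀ a ∈ A, a ∉ I) (hB : ∀ b ∈ B, b ∉ I) :
    ContainsSixNeighbors G I A B := by
  classical
  have hg : ∀ x, ∃ z, x ∈ A ∪ B → z ∈ I ∧ G.Adj z x := fun x => by
    by_cases hx : x ∈ A ∪ B
    · obtain ⟨z, hz⟩ := exists_adj_of_notMem hI ((mem_union.1 hx).elim (hA x) (hB x))
      exact ⟨z, fun _ => hz⟩
    · exact ⟨x, fun h => absurd h hx⟩
  choose g hg using hg
  have hinj : Set.InjOn g ↑(A ∪ B) := fun x hx y hy he => by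
    obtain ⟨hxI, hgx⟩ := hg x hx
    obtain ⟨-, hgy⟩ := hg y hy
    rw [← he] at hgy
    rcases mem_union.1 (mem_coe.1 hx) with hx | hx <;>
      rcases mem_union.1 (mem_coe.1 hy) with hy | hy
    · exact eq_of_common_neighbor hG hd hI h hA hB hx hy hxI hgx hgy
    · exact absurd (h.2.2 x hx y hy) (not_adj_of_common_neighbor hG hgx hgy)
    · exact absurd (h.2.2 y hy x hx) (not_adj_of_common_neighbor hG hgy hgx)
    · exact eq_of_common_neighbor hG hd hI h.symm hB hA hx hy hxI hgx hgy
  refine ⟨(A ∪ B).image g, fun z hz => ?_, ?_, fun z hz => ?_⟩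
  · obtain ⟨x, hx, rfl⟩ := mem_image.1 hz
    exact (hg x hx).1
  · rw [card_image_of_injOn hinj, card_union_of_disjoint
      (disjoint_left.2 fun a ha => h.notMem_right ha), h.1, h.2.1]
  · obtain ⟨x, hx, rfl⟩ := mem_image.1 hz
    obtain ⟨hxI, hgx⟩ := hg x hx
    exact ⟨fun hA' => hA _ hA' hxI, fun hB' => hB _ hB' hxI, x, mem_union.1 hx, hgx⟩

theorem exists_colorsComponentsEquitably_minus (hG : G.IsBipartite) (hd : DegreeLE G 4)
    (hI : G.IsMaximumIndepSet I)
    (h : ∀ A B : Finset V, IsK33 G A B → ¬ ContainsSixNeighbors G I A B) :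
    ∃ c, ColorsComponentsEquitably (minus G I) c := by
  classical
  refine exists_colorsComponentsEquitably (hG.of_hom (SimpleGraph.Embedding.comap
    (Function.Embedding.subtype _) G).toHom) (degreeLE_minus hd hI) fun A B hK => ?_
  have hK' := hK.map (G := G) (Function.Embedding.subtype _) fun _ _ h => h
  have hn : ∀ S : Finset {v // v ∉ I}, ∀ a ∈ S.map (Function.Embedding.subtype _), a ∉ I :=
    fun S a ha => by
      obtain ⟨z, -, rfl⟩ := mem_map.1 ha
      exact z.2
  exact h _ _ hK' (containsSixNeighbors_of_forall_notMem hG hd hI hK' (hn A) (hn B))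

/-- The edges between a maximum independent set and its complement are counted: there is at least
one at each vertex of the former, and there are at most four at each vertex of the latter. -/
theorem card_le_four_mul (hd : DegreeLE G 4) (hpos : ∀ v, ∃ z, G.Adj v z)
    (hI : G.IsIndepSet I) : #I ≤ 4 * (Fintype.card V - #I) := by
  classical
  rw [← card_compl]
  have := card_mul_le_card_mul G.Adj (s := I) (t := Iᶜ) (m := 1) (n := 4)
    (fun a ha => by
      obtain ⟨z, hz⟩ := hpos a
      exact card_pos.2 ⟨z, by
        simpa [bipartiteAbove, hz] using fun hzI => hI ha hzI hz.ne hz⟩)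
    (fun b _ => hd b _ fun z hz => by
      simp only [bipartiteBelow, mem_filter] at hz
      exact hz.2.symm)
  omega

end K33

/-! ### The assignment that is returned -/

section Optimality

variable {V : Type*} {G : SimpleGraph V} {I : Finset V}

theorem isSchedule_assign (hI : G.IsIndepSet I) {d : {v // v ∉ I} → Fin 3}
    (hd : ∀ u w, (minus G I).Adj u w → d u ≠ d w) : IsSchedule G (assign I d) := by
  intro u v huv
  by_cases hu : u ∈ I <;> by_cases hv : v ∈ I
  · exact absurd huv (hI hu hv huv.ne)
  · simp [assign, hu, hv, (Fin.succ_ne_zero _).symm]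
  · simp [assign, hu, hv, Fin.succ_ne_zero]
  · simpa [assign, hu, hv] using hd ⟨u, hu⟩ ⟨v, hv⟩ huv

variable [Fintype V]

theorem sum_load (σ : V → Fin 4) : ∑ i, load σ i = Fintype.card V := by
  classical
  exact (card_eq_sum_card_fiberwise (s := univ) (t := univ) (by simp)).symm

theorem load_assign_zero (d : {v // v ∉ I} → Fin 3) : load (assign I d) 0 = #I := by
  classical
  unfold load assign
  congr 1
  ext v
  by_cases hv : v ∈ I <;> simp [hv, Fin.succ_ne_zero]

theorem load_assign_succ (d : {v // v ∉ I} → Fin 3) (i : Fin 3) :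
    load (assign I d) i.succ = {w | d w = i}.ncard := by
  classical
  rw [load, ← Set.ncard_coe_finset, ← Set.ncard_image_of_injective _ Subtype.val_injective]
  congr 1
  ext v
  by_cases hv : v ∈ I
  · simp [assign, hv, (Fin.succ_ne_zero i).symm]
  · simp [assign, hv]

/-- At most as many jobs as in the maximum independent set `I` can be on the first machine, so one
of the equally fast machines gets at least a third of the remaining ones.  This bounds the three
classes, as these are equitable, and also `|I| / s 0`, since `|I| ≤ 4 (|V| - |I|)`. -/
theorem isOptimalSchedule_assign (hd : DegreeLE G 4) (hpos : ∀ v, ∃ z, G.Adj v z)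
    (hI : G.IsMaximumIndepSet I) {d : {v // v ∉ I} → Fin 3}
    (hproper : ∀ u w, (minus G I).Adj u w → d u ≠ d w) (heq : HasEquitableClasses d)
    {s : Fin 4 → ℝ} (hs : ∀ i, 0 < s i) (h12 : 12 * s 1 ≤ s 0)
    (hs1 : ∀ i : Fin 3, s i.succ = s 1) : IsOptimalSchedule G s (assign I d) := by
  refine ⟨isSchedule_assign hI.isIndepSet hproper, fun τ hτ => ?_⟩
  have hτ0 : load τ 0 ≤ #I := by
    classical
    refine hI.maximum _ fun u hu v hv _ huv => hτ u v huv ?_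
    simp only [coe_filter, mem_univ, true_and, Set.mem_ofPred_eq] at hu hv
    rw [hu, hv]
  have hsumτ := sum_load τ
  have hsum := sum_load (assign I d)
  rw [Fin.sum_univ_succ] at hsumτ hsum
  simp only [load_assign_zero, load_assign_succ] at hsum
  have h4 := card_le_four_mul hd hpos hI.isIndepSet
  obtain ⟨j, hj⟩ : ∃ j : Fin 3, ∀ i : Fin 3, load τ i.succ ≤ load τ j.succ := by
    obtain ⟨j, -, hj⟩ := exists_max_image (univ : Finset (Fin 3)) (fun i => load τ i.succ) (by simp)
    exact ⟨j, fun i => hj i (mem_univ i)⟩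
  have hge : (load τ j.succ : ℝ) / s 1 ≤ length s τ := by
    rw [← hs1 j]
    exact le_sup' (fun i => (load τ i : ℝ) / s i) (mem_univ j.succ)
  have hj3 : ∑ i : Fin 3, load τ i.succ ≤ 3 * load τ j.succ :=
    (sum_le_card_nsmul _ _ _ fun i _ => hj i).trans (by simp)
  refine sup'_le _ _ fun i _ => le_trans ?_ hge
  cases i using Fin.cases with
  | zero =>
    rw [load_assign_zero]
    have h : (#I : ℝ) ≤ 12 * load τ j.succ := by
      have : #I ≤ 12 * load τ j.succ := by omega
      exact_mod_cast this
    rw [div_le_div_iff₀ (hs 0) (hs 1)]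
    have hs1' := hs 1
    calc (#I : ℝ) * s 1 ≤ 12 * load τ j.succ * s 1 := by gcongr
      _ = load τ j.succ * (12 * s 1) := by ring
      _ ≤ load τ j.succ * s 0 := by gcongr
  | succ i =>
    rw [load_assign_succ, hs1 i]
    have h : {w | d w = i}.ncard ≤ load τ j.succ := by
      have h0 := heq i 0
      have h1 := heq i 1
      have h2 := heq i 2
      rw [Fin.sum_univ_three] at hsum
      fin_cases i <;> simp only [Fin.zero_eta, Fin.mk_one, Fin.reduceFinMk] at * <;> omega
    have hs1' := hs 1
    gcongr

end Optimality

/-! ### The runs of the algorithm -/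

section Runs

variable {V : Type*} [Fintype V] {G : SimpleGraph V}

/-- What is known about the states that are reached. -/
def Valid (G : SimpleGraph V) : State V → Prop
  | .start => True
  | .selected I₀ I => G.IsMaximumIndepSet I₀ ∧ G.IsMaximumIndepSet I ∧ NewVerticesInK33 G I₀ I
  | .assigned I => G.IsMaximumIndepSet I ∧
      ∀ A B : Finset V, IsK33 G A B → ¬ ContainsSixNeighbors G I A B
  | .colored I c => G.IsMaximumIndepSet I ∧ ColorsComponentsEquitably (minus G I) c
  | .done σ => ∃ I, G.IsMaximumIndepSet I ∧ ∃ d : {v // v ∉ I} → Fin 3,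
      (∀ u w, (minus G I).Adj u w → d u ≠ d w) ∧ HasEquitableClasses d ∧ σ = assign I d

theorem Valid.step (hd : DegreeLE G 4) {q q' : State V} (hq : Valid G q) (h : Step G q q') :
    Valid G q' := by
  classical
  cases h with
  | select I hI => exact ⟨hI, hI, fun w hw hw' => absurd hw hw'⟩
  | interchange I₀ I A B u v hK hN hu hu₀ hv huv =>
    obtain ⟨h1, h2, h3⟩ := hq
    refine ⟨h1, ?_, ?_⟩
    · convert isMaximumIndepSet_interchange hd h2 hK hN hu hv huv
    · convert newVerticesInK33_interchange hd h2.isIndepSet h3 hK hN hu hu₀ hv huv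
  | assign I₀ I h => exact ⟨hq.2.1, h⟩
  | color I c hc => exact ⟨hq.1, hc⟩
  | combine I c π hπ => exact ⟨I, hq.1, _, fun _ _ => combine_ne_of_adj hq.2 π, hπ, rfl⟩

theorem Valid.of_reachable (hd : DegreeLE G 4) {q : State V} (h : Reachable G q) : Valid G q := by
  induction h with
  | refl => trivial
  | tail _ hstep ih => exact ih.step hd hstep

open scoped Classical in
/-- A bound for the number of steps that remain. -/
noncomputable def remaining : State V → ℕ
  | .start => Fintype.card V + 4
  | .selected I₀ I => #(I ∩ I₀) + 3
  | .assigned _ => 2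
  | .colored _ _ => 1
  | .done _ => 0

theorem remaining_lt {q q' : State V} (hq : Valid G q) (h : Step G q q') :
    remaining q' < remaining q := by
  classical
  cases h with
  | select I hI =>
    have := card_le_univ (I ∩ I)
    simp only [remaining]
    omega
  | interchange I₀ I A B u v hK hN hu hu₀ hv huv =>
    have := card_inter_interchange_lt hq.1.isIndepSet hu hu₀ huv
    simp only [remaining]
    convert Nat.add_lt_add_right this 3
  | assign I₀ I h => simp only [remaining]; omega
  | color I c hc => simp [remaining]
  | combine I c π hπ => simp [remaining]

theorem terminates (hd : DegreeLE G 4) : Terminates G := by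
  rintro ⟨run, h0, hstep⟩
  have hreach : ∀ k, Reachable G (run k) := fun k => by
    induction k with
    | zero => rw [h0]; exact .refl
    | succ k ih => exact ih.tail (hstep k)
  have hbound : ∀ k, remaining (run k) + k ≤ remaining (run 0) := fun k => by
    induction k with
    | zero => simp
    | succ k ih =>
      have := remaining_lt (Valid.of_reachable hd (hreach k)) (hstep k)
      omega
  have := hbound (remaining (run 0) + 1)
  omega

theorem neverStuck (hG : G.IsBipartite) (hd : DegreeLE G 4) : NeverStuck G := by
  classical
  intro q hq
  have hv := Valid.of_reachable hd hq
  cases q with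
  | start =>
    obtain ⟨I, hI⟩ := G.maximumIndepSet_exists
    exact Or.inr ⟨_, .select I hI⟩
  | selected I₀ I =>
    by_cases h : ∀ A B : Finset V, IsK33 G A B → ¬ ContainsSixNeighbors G I A B
    · exact Or.inr ⟨_, .assign I₀ I h⟩
    · push Not at h
      obtain ⟨A, B, hK, hN⟩ := h
      obtain ⟨v, u, hvK, hu, hu₀, huv⟩ := exists_interchange hd hv.1.isIndepSet hv.2.2 hK hN
      exact Or.inr ⟨_, .interchange I₀ I A B u v hK hN hu hu₀ hvK huv⟩
  | assigned I =>
    obtain ⟨c, hc⟩ := exists_colorsComponentsEquitably_minus hG hd hv.1 hv.2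
    exact Or.inr ⟨_, .color I c hc⟩
  | colored I c =>
    obtain ⟨π, hπ⟩ := exists_hasEquitableClasses hv.2
    exact Or.inr ⟨_, .combine I c π hπ⟩
  | done σ => exact Or.inl ⟨σ, rfl⟩

end Runs

end FourMachines

theorem theorem2 {V : Type*} [Fintype V] (G : SimpleGraph V) [DecidableRel G.Adj]
    (hG : G.IsBipartite) (hdeg : ∀ v, 1 ≤ G.degree v ∧ G.degree v ≤ 4)
    (s : Fin 4 → ℝ) (hpos : ∀ i, 0 < s i)
    (h12 : 12 * s 1 ≤ s 0) (h23 : s 1 = s 2) (h34 : s 2 = s 3) :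
    FourMachines.Terminates G ∧ FourMachines.NeverStuck G ∧
      ∀ σ : V → Fin 4, FourMachines.Reachable G (.done σ) →
        FourMachines.IsOptimalSchedule G s σ := by
  have hd : FourMachines.DegreeLE G 4 := fun v S hS =>
    (Finset.card_le_card fun z hz => (G.mem_neighborFinset v z).2 (hS z hz)).trans (hdeg v).2
  have hex : ∀ v, ∃ z, G.Adj v z := fun v => (G.degree_pos_iff_exists_adj v).1 (hdeg v).1
  refine ⟨FourMachines.terminates hd, FourMachines.neverStuck hG hd, fun σ hσ => ?_⟩
  obtain ⟨I, hI, d, hproper, heq, rfl⟩ := FourMachines.Valid.of_reachable hd hσ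
  refine FourMachines.isOptimalSchedule_assign hd hex hI hproper heq hpos h12 fun i => ?_
  fin_cases i
  · rfl
  · exact h23.symm
  · exact (h23.trans h34).symm
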